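/- Let $\mathbb K$ be a field of characteristic $0$, $S=\mathbb K[x,y,z]$ with its standard grading, $l_1,\dots,l_n\in S_1$ linear forms and $d_1,\dots,d_n$ non-negative integers, and put $I=\langle l_1^{d_1},\dots,l_n^{d_n}\rangle$. Suppose that $A=S/I$ is Artinian and that \[ d_{t+1}\le \frac{\sum_{i=1}^{t}d_i-t}{t-1}\qquad\text{for all } t \text{ with } 1<t<n . \] Then $A$ has the weak Lefschetz property: there is a linear form $\ell\in S_1$ such that for every $m\ge 0$ the multiplication map $A_m\xrightarrow{\ \cdot\ell\ }A_{m+1}$ is injective or surjective. -/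

import Mathlib

noncomputable section

namespace WeakLefschetz

variable {σ K : Type*} [Field K]

/-- The degree `m` piece `A_m` of `A = S/I`, where `S = K[x_i : i ∈ σ]` has the standard grading:
the image of `S_m` in `S/I`. -/
def gradedPiece (I : Ideal (MvPolynomial σ K)) (m : ℕ) :
    Submodule K (MvPolynomial σ K ⧸ I) :=
  (MvPolynomial.homogeneousSubmodule σ K m).map (Ideal.Quotient.mkₐ K I).toLinearMap

theorem mul_mem_gradedPiece (I : Ideal (MvPolynomial σ K)) {l : MvPolynomial σ K}
    (hl : l.IsHomogeneous 1) (m : ℕ) :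
    ∀ a ∈ gradedPiece I m,
      LinearMap.mulLeft K (Ideal.Quotient.mk I l) a ∈ gradedPiece I (m + 1) := by
  rintro _ ⟨f, hf, rfl⟩
  refine ⟨l * f, ?_, by simp⟩
  rw [add_comm m 1]
  exact hl.mul hf

/-- Multiplication by a linear form `l`, as a `K`-linear map `A_m → A_{m+1}`. -/
def mulMap (I : Ideal (MvPolynomial σ K)) {l : MvPolynomial σ K}
    (hl : l.IsHomogeneous 1) (m : ℕ) : gradedPiece I m →ₗ[K] gradedPiece I (m + 1) :=
  (LinearMap.mulLeft K (Ideal.Quotient.mk I l)).restrict (mul_mem_gradedPiece I hl m)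

/-- The weak Lefschetz property of `S/I` (for a homogeneous ideal `I` with `S/I` Artinian):
some `l ∈ S_1` makes every multiplication map `A_m → A_{m+1}` injective or surjective. -/
def HasWLP (I : Ideal (MvPolynomial σ K)) : Prop :=
  ∃ (l : MvPolynomial σ K) (hl : l.IsHomogeneous 1), ∀ m : ℕ,
    Function.Injective (mulMap I hl m) ∨ Function.Surjective (mulMap I hl m)

end WeakLefschetz

end

/-! Cut by a general plane `ℓ = 0`. There the forms `l i` become pairwise non-proportional binary
forms or, dehomogenized, multiples of `X - a i` with distinct `a i`. In degree `m + 1` the `i`-th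
generator spans the polynomials of degree at most `m + 1` vanishing to order `d i` at `a i`. In
characteristic zero such spaces are as independent as dimensions allow: their sum is direct or
everything. If direct, a relation `ℓ * f = ∑ g i * l i ^ d i` restricts to zero term by term, so `ℓ`
divides each `g i` and `f ∈ I`: injectivity. If everything, any form of degree `m + 1` lies in `I`
modulo `ℓ`: surjectivity. A minimal subfamily of generators reduces to non-proportional forms. -/

/-! ### Univariate polynomials with prescribed vanishing orders -/

open Polynomial in
/-- If `m p` equals `X - a` times the derivative of `p`, then `p` is a multiple of `(X - a) ^ m`. -/
theorem Polynomial.eq_C_mul_X_sub_C_pow_of_smul_eq_mul_derivative {K : Type*} [Field K] [CharZero K]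
    {m : ℕ} {a : K} {p : K[X]} (h : (m : K[X]) * p = (X - C a) * derivative p) :
    ∃ c, p = C c * (X - C a) ^ m := by
  set q := p.comp (X + C a) with hq
  have hp : p = q.comp (X - C a) := by simp [hq, comp_assoc]
  have h' : (m : K[X]) * q = X * derivative q := by
    have := congrArg (fun r => r.comp (X + C a)) h
    simpa [hq, derivative_comp] using this
  refine ⟨q.coeff m, ?_⟩
  have hqm : q = C (q.coeff m) * X ^ m := by
    ext k
    rw [coeff_C_mul_X_pow]
    split_ifs with hk
    · rw [hk]
    · have := congrArg (fun r => r.coeff k) h'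
      simp only [← C_eq_natCast, coeff_C_mul] at this
      rcases k with _ | k
      · simp only [mul_coeff_zero, coeff_X_zero, zero_mul, mul_eq_zero, Nat.cast_eq_zero] at this
        exact this.resolve_left (fun h => hk h.symm)
      · rw [coeff_X_mul, coeff_derivative] at this
        have h2 : ((m : K) - ((k + 1 : ℕ) : K)) * q.coeff (k + 1) = 0 := by
          push_cast; linear_combination this
        refine (mul_eq_zero.1 h2).resolve_left (sub_ne_zero.2 ?_)
        exact_mod_cast Ne.symm hk
  nth_rw 1 [hp, hqm]
  simp

-- The coefficients of degree `m + 1` cancel; this drop in degree drives the induction below.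
open Polynomial in
theorem Polynomial.natDegree_smul_sub_mul_derivative_le {K : Type*} [Field K]
    {m : ℕ} (a : K) {p : K[X]} (hp : p.natDegree ≤ m + 1) :
    (((m + 1 : ℕ) : K[X]) * p - (X - C a) * derivative p).natDegree ≤ m := by
  rw [natDegree_le_iff_coeff_eq_zero]
  intro k hk
  obtain ⟨k, rfl⟩ : ∃ j, k = j + 1 := ⟨k - 1, by omega⟩
  have h2 : p.coeff (k + 1 + 1) = 0 := coeff_eq_zero_of_natDegree_lt (by omega)
  rw [sub_mul, coeff_sub, coeff_sub, coeff_X_mul, coeff_C_mul, coeff_derivative, coeff_derivative,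
    ← C_eq_natCast, coeff_C_mul, h2]
  rcases (show m ≤ k by omega).eq_or_lt with rfl | hlt
  · push_cast; ring
  · rw [coeff_eq_zero_of_natDegree_lt (show p.natDegree < k + 1 by omega)]; simp

open Polynomial in
/-- For distinct points `a i`, the spaces of polynomials of degree at most `m` that vanish to order
`d i` at `a i` are linearly independent as soon as the sum of their dimensions is at most `m + 1`. -/
theorem Polynomial.eq_zero_of_sum_eq_zero_of_X_sub_C_pow_dvd {K ι : Type*} [Field K] [CharZero K]
    [Fintype ι] {a : ι → K} (ha : Function.Injective a) (m : ℕ) (d : ι → ℕ)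
    (hd : ∑ i, (m + 1 - d i) ≤ m + 1) (p : ι → K[X]) (hdeg : ∀ i, (p i).natDegree ≤ m)
    (hdvd : ∀ i, (X - C (a i)) ^ d i ∣ p i) (hsum : ∑ i, p i = 0) (i : ι) : p i = 0 := by
  classical
  induction m generalizing d p i with
  | zero =>
    have hz : ∀ i, 0 < d i → p i = 0 := fun i hi => by
      refine eq_zero_of_dvd_of_natDegree_lt (hdvd i) ?_
      simpa using lt_of_le_of_lt (hdeg i) hi
    rcases (d i).eq_zero_or_pos with hi | hi
    · rw [Finset.sum_eq_single i ?_ (by simp)] at hsum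
      · exact hsum
      · intro j _ hji
        refine hz j (Nat.pos_of_ne_zero fun hj => ?_)
        have := Finset.sum_le_sum_of_subset (f := fun i => 0 + 1 - d i) (Finset.subset_univ {i, j})
        rw [Finset.sum_pair hji.symm] at this
        omega
    · exact hz i hi
  | succ m ih =>
    by_cases hall : ∀ j, m + 1 < d j
    · refine eq_zero_of_dvd_of_natDegree_lt (hdvd i) ?_
      simpa using lt_of_le_of_lt (hdeg i) (hall i)
    push Not at hall
    obtain ⟨j, hj⟩ := hall
    -- If `d i = 0`, then `i` alone uses up the bound `m + 2`, while `j` contributes at least `1`.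
    have hpos : ∀ i, i ≠ j → 1 ≤ d i := fun i hij => by
      have := Finset.sum_le_sum_of_subset (f := fun i => m + 1 + 1 - d i)
        (Finset.subset_univ {i, j})
      rw [Finset.sum_pair hij] at this
      omega
    -- This operator costs one order of vanishing at `a i` for `i ≠ j` but none at `a j`. As the
    -- degree bound falls by one, only the `j`-th dimension drops, and the inequality persists.
    have hD : ∀ i, ((m + 1 : ℕ) : K[X]) * p i - (X - C (a j)) * derivative (p i) = 0 := by
      refine ih (fun i => if i = j then d i else d i - 1) ?_ _
        (fun i => natDegree_smul_sub_mul_derivative_le _ (hdeg i)) ?_ ?_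
      · rw [← Finset.add_sum_erase _ _ (Finset.mem_univ j)] at hd ⊢
        have : ∑ i ∈ Finset.univ.erase j, (m + 1 - if i = j then d i else d i - 1)
            = ∑ i ∈ Finset.univ.erase j, (m + 1 + 1 - d i) := by
          refine Finset.sum_congr rfl fun i hi => ?_
          have hij := Finset.ne_of_mem_erase hi
          have := hpos i hij
          rw [if_neg hij]
          omega
        rw [this, if_pos rfl]
        omega
      · intro i
        obtain ⟨g, hg⟩ := hdvd i
        split_ifs with hij
        · subst hij
          rcases Nat.eq_zero_or_pos (d i) with h0 | h0
          · simp [h0]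
          · obtain ⟨e, he⟩ : ∃ e, d i = e + 1 := ⟨d i - 1, by omega⟩
            rw [he] at hg ⊢
            refine dvd_sub (Dvd.dvd.mul_left ⟨g, hg⟩ _) ?_
            rw [hg, derivative_mul, derivative_X_sub_C_pow]
            refine ⟨C ((e + 1 : ℕ) : K) * g + (X - C (a i)) * derivative g, ?_⟩
            simp only [Nat.add_sub_cancel]
            ring
        · obtain ⟨e, he⟩ : ∃ e, d i = e + 1 := ⟨d i - 1, by have := hpos i hij; omega⟩
          rw [he] at hg ⊢
          refine dvd_sub (Dvd.dvd.mul_left ?_ _) (Dvd.dvd.mul_left ?_ _)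
          · exact (pow_dvd_pow _ (by omega)).trans ⟨g, hg⟩
          · rw [hg, derivative_mul, derivative_X_sub_C_pow]
            simp only [Nat.add_sub_cancel]
            refine ⟨C ((e + 1 : ℕ) : K) * g + (X - C (a i)) * derivative g, ?_⟩
            ring
      · rw [Finset.sum_sub_distrib, ← Finset.mul_sum, ← Finset.mul_sum, ← derivative_sum, hsum]
        simp
    -- The operator kills only multiples of `(X - C (a j)) ^ (m + 1)`, which do not vanish at `a i`
    -- unless zero.
    have hz : ∀ i, i ≠ j → p i = 0 := fun i hij => by
      obtain ⟨c, hc⟩ := eq_C_mul_X_sub_C_pow_of_smul_eq_mul_derivative (sub_eq_zero.1 (hD i))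
      have h0 : (p i).eval (a i) = 0 := by
        obtain ⟨g, hg⟩ := hdvd i
        have := hpos i hij
        rw [hg, eval_mul, eval_pow]
        simp [show d i ≠ 0 by omega]
      rw [hc] at h0
      simp only [eval_mul, eval_C, eval_pow, eval_sub, eval_X, mul_eq_zero] at h0
      have : a i - a j ≠ 0 := sub_ne_zero.2 (ha.ne hij)
      rw [hc, h0.resolve_right (pow_ne_zero _ this)]
      simp
    by_cases hij : i = j
    · subst hij
      rwa [Finset.sum_eq_single i (fun k _ hk => hz k hk) (by simp)] at hsum
    · exact hz i hij

theorem Fintype.exists_le_sum_eq {ι : Type*} [Fintype ι] (k : ι → ℕ) {N : ℕ} (h : N ≤ ∑ i, k i) :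
    ∃ k' : ι → ℕ, k' ≤ k ∧ ∑ i, k' i = N := by
  classical
  induction N with
  | zero => exact ⟨0, fun i => Nat.zero_le _, by simp⟩
  | succ N ih =>
    obtain ⟨k', hle, hsum⟩ := ih (by omega)
    obtain ⟨i, hi⟩ : ∃ i, k' i < k i := by
      by_contra! hcon
      have := Finset.sum_le_sum (s := Finset.univ) fun i _ => hcon i
      omega
    refine ⟨k' + Pi.single i 1, fun j => ?_, by simp [Finset.sum_add_distrib, hsum]⟩
    rcases eq_or_ne j i with rfl | hj
    · simpa using hi
    · simpa [hj] using hle j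

open Polynomial in
/-- For distinct points `a i`, the spaces of polynomials of degree at most `m` that vanish to order
`d i` at `a i` span as soon as the sum of their dimensions is at least `m + 1`. -/
theorem Polynomial.exists_sum_eq_of_X_sub_C_pow_mul {K ι : Type*} [Field K] [CharZero K]
    [Fintype ι] {a : ι → K} (ha : Function.Injective a) (m : ℕ) (d : ι → ℕ)
    (hd : m + 1 ≤ ∑ i, (m + 1 - d i)) (q : K[X]) (hq : q.natDegree ≤ m) :
    ∃ g : ι → K[X], (∀ i, m < d i → g i = 0) ∧ (∀ i, (g i).natDegree ≤ m - d i) ∧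
      ∑ i, (X - C (a i)) ^ d i * g i = q := by
  -- Raising the vanishing orders to `m + 1 - k i` makes the dimensions add up to exactly `m + 1`,
  -- so independence gives spanning.
  obtain ⟨k, hk, hsum⟩ := Fintype.exists_le_sum_eq _ hd
  have hk' : ∀ i, k i ≤ m + 1 - d i := hk
  let f : (∀ i, degreeLT K (k i)) →ₗ[K] degreeLT K (m + 1) :=
    LinearMap.codRestrict _
      (∑ i, (LinearMap.mulLeft K ((X - C (a i)) ^ (m + 1 - k i))).comp
        ((degreeLT K (k i)).subtype.comp (LinearMap.proj i))) (fun g => by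
      rw [LinearMap.sum_apply]
      refine Submodule.sum_mem _ fun i _ => ?_
      have hi := mem_degreeLT.1 (g i).2
      have := hk' i
      rw [mem_degreeLT]
      rcases eq_or_ne (g i : K[X]) 0 with h0 | h0
      · simp [h0]
      · have hn := (natDegree_lt_iff_degree_lt h0).2 hi
        simp only [LinearMap.comp_apply, LinearMap.mulLeft_apply, LinearMap.proj_apply,
          Submodule.subtype_apply]
        refine (natDegree_lt_iff_degree_lt (mul_ne_zero (pow_ne_zero _ (X_sub_C_ne_zero _)) h0)).1 ?_
        rw [natDegree_mul (pow_ne_zero _ (X_sub_C_ne_zero _)) h0, natDegree_pow, natDegree_X_sub_C]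
        omega)
  have hf : ∀ g, (f g : K[X]) = ∑ i, (X - C (a i)) ^ (m + 1 - k i) * (g i : K[X]) := fun g => by
    simp [f, LinearMap.sum_apply]
  have hfin : Module.finrank K (∀ i, degreeLT K (k i)) = Module.finrank K (degreeLT K (m + 1)) := by
    have hr : ∀ n, Module.finrank K (degreeLT K n) = n := fun n => by
      rw [(degreeLTEquiv K n).finrank_eq]; simp
    rw [Module.finrank_pi_fintype, hr]
    simp [hr, hsum]
  have hinj : Function.Injective f := by
    rw [injective_iff_map_eq_zero]
    intro g hg
    have h0 : ∑ i, (X - C (a i)) ^ (m + 1 - k i) * (g i : K[X]) = 0 := by rw [← hf, hg]; rfl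
    funext i
    have hi := eq_zero_of_sum_eq_zero_of_X_sub_C_pow_dvd ha m (fun i => m + 1 - k i)
      (by
        rw [← hsum]
        refine Finset.sum_le_sum fun i _ => ?_
        have := hk' i
        omega) _ (fun i => ?_) (fun i => Dvd.intro _ rfl) h0 i
    · exact Subtype.ext ((mul_eq_zero.1 hi).resolve_left (pow_ne_zero _ (X_sub_C_ne_zero _)))
    · rcases eq_or_ne (g i : K[X]) 0 with h0 | h0
      · simp [h0]
      · have hn := (natDegree_lt_iff_degree_lt h0).2 (mem_degreeLT.1 (g i).2)
        rw [natDegree_mul (pow_ne_zero _ (X_sub_C_ne_zero _)) h0, natDegree_pow, natDegree_X_sub_C]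
        have := hk' i
        omega
  have : ∀ n, Module.Finite K (degreeLT K n) := fun n => Module.Finite.equiv (degreeLTEquiv K n).symm
  obtain ⟨g, hg⟩ := (LinearMap.injective_iff_surjective_of_finrank_eq_finrank hfin).1 hinj
    ⟨q, mem_degreeLT.2 (lt_of_le_of_lt (degree_le_of_natDegree_le hq) (by exact_mod_cast m.lt_succ_self))⟩
  have hg0 : ∀ i, k i = 0 → (g i : K[X]) = 0 := fun i hi => by
    have := (mem_degreeLT.1 (g i).2).trans_le (WithBot.coe_le_coe.2 hi.le)
    simpa using this
  refine ⟨fun i => (X - C (a i)) ^ (m + 1 - k i - d i) * (g i : K[X]), fun i hi => ?_, fun i => ?_, ?_⟩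
  · have := hk' i
    simp [hg0 i (by omega)]
  · rcases eq_or_ne (g i : K[X]) 0 with h0 | h0
    · simp [h0]
    · have hn := (natDegree_lt_iff_degree_lt h0).2 (mem_degreeLT.1 (g i).2)
      rw [natDegree_mul (pow_ne_zero _ (X_sub_C_ne_zero _)) h0, natDegree_pow, natDegree_X_sub_C]
      have := hk' i
      omega
  · have := hf g
    rw [hg] at this
    refine Eq.trans (Finset.sum_congr rfl fun i _ => ?_) this.symm
    rcases Nat.eq_zero_or_pos (k i) with h0 | h0
    · simp [hg0 i h0]
    · have := hk' i
      rw [← mul_assoc, ← pow_add]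
      congr 2
      omega

/-! ### Multiplication maps and homogeneous representatives -/

namespace WeakLefschetz

variable {σ K : Type*} [Field K]

theorem mulMap_injective_of_forall {I : Ideal (MvPolynomial σ K)} {l : MvPolynomial σ K}
    (hl : l.IsHomogeneous 1) {m : ℕ}
    (h : ∀ f : MvPolynomial σ K, f.IsHomogeneous m → l * f ∈ I → f ∈ I) :
    Function.Injective (mulMap I hl m) := by
  rw [injective_iff_map_eq_zero]
  rintro ⟨_, f, hf, rfl⟩ hz
  have hz' : Ideal.Quotient.mk I (l * f) = 0 := by
    simpa [mulMap] using congrArg Subtype.val hz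
  exact Subtype.ext (Ideal.Quotient.eq_zero_iff_mem.2 (h f hf (Ideal.Quotient.eq_zero_iff_mem.1 hz')))

theorem mulMap_surjective_of_forall {I : Ideal (MvPolynomial σ K)} {l : MvPolynomial σ K}
    (hl : l.IsHomogeneous 1) {m : ℕ}
    (h : ∀ f : MvPolynomial σ K, f.IsHomogeneous (m + 1) →
      ∃ g : MvPolynomial σ K, g.IsHomogeneous m ∧ l * g - f ∈ I) :
    Function.Surjective (mulMap I hl m) := by
  rintro ⟨_, f, hf, rfl⟩
  obtain ⟨g, hg, hgf⟩ := h f hf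
  refine ⟨⟨_, g, hg, rfl⟩, Subtype.ext ?_⟩
  simpa [mulMap] using Ideal.Quotient.eq.2 hgf

open MvPolynomial

theorem homogeneousComponent_mul_of_isHomogeneous_right {f g : MvPolynomial σ K} {n i : ℕ}
    (hg : g.IsHomogeneous i) :
    homogeneousComponent n (f * g) = if i ≤ n then homogeneousComponent (n - i) f * g else 0 := by
  classical
  let := gradedAlgebra (σ := σ) (R := K)
  have hc : ∀ (p : MvPolynomial σ K) (j : ℕ),
      (DirectSum.decompose (homogeneousSubmodule σ K) p j : MvPolynomial σ K) =
        homogeneousComponent j p := fun p j => decomposition.decompose'_apply p j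
  rw [← hc, ← hc]
  exact DirectSum.coe_decompose_mul_of_right_mem (homogeneousSubmodule σ K) n
    ((mem_homogeneousSubmodule i g).2 hg)

theorem exists_isHomogeneous_of_dvd {f g : MvPolynomial σ K} {m i : ℕ}
    (hf : f.IsHomogeneous (m + i)) (hg : g.IsHomogeneous i) (h : g ∣ f) :
    ∃ q : MvPolynomial σ K, q.IsHomogeneous m ∧ f = g * q := by
  obtain ⟨q, rfl⟩ := h
  refine ⟨_, homogeneousComponent_isHomogeneous m q, ?_⟩
  have := homogeneousComponent_mul_of_isHomogeneous_right (n := m + i) (f := q) hg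
  rw [mul_comm q g, homogeneousComponent_eq_self hf] at this
  simpa [mul_comm] using this

theorem exists_isHomogeneous_of_mem_span {ι : Type*} [Fintype ι] {p : ι → MvPolynomial σ K}
    {d : ι → ℕ} (hp : ∀ i, (p i).IsHomogeneous (d i)) {f : MvPolynomial σ K} {m : ℕ}
    (hf : f.IsHomogeneous m) (h : f ∈ Ideal.span (Set.range p)) :
    ∃ g : ι → MvPolynomial σ K, (∀ i, (g i).IsHomogeneous (m - d i)) ∧
      (∀ i, m < d i → g i = 0) ∧ ∑ i, g i * p i = f := by
  obtain ⟨c, hc⟩ := Ideal.mem_span_range_iff_exists_fun.1 h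
  refine ⟨fun i => if d i ≤ m then homogeneousComponent (m - d i) (c i) else 0, fun i => ?_,
    fun i hi => if_neg (by omega), ?_⟩
  · dsimp only
    split_ifs
    · exact homogeneousComponent_isHomogeneous _ _
    · exact isHomogeneous_zero _ _ _
  · rw [← homogeneousComponent_eq_self hf, ← hc, map_sum]
    refine Finset.sum_congr rfl fun i _ => ?_
    rw [homogeneousComponent_mul_of_isHomogeneous_right (hp i), ite_mul, zero_mul]

theorem exists_eval_ne_zero [Infinite K] {p : MvPolynomial σ K} (hp : p ≠ 0) :
    ∃ x : σ → K, eval x p ≠ 0 := by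
  by_contra! h
  exact hp (MvPolynomial.funext fun x => by simpa using h x)

/-! ### Restriction to a general line -/

/-- The restriction of polynomials to the affine line through `v` with direction `u`. -/
noncomputable def lineRestrict (u v : σ → K) : MvPolynomial σ K →ₐ[K] Polynomial K :=
  aeval fun i => Polynomial.C (u i) * Polynomial.X + Polynomial.C (v i)

theorem lineRestrict_X (u v : σ → K) (i : σ) :
    lineRestrict u v (X i) = Polynomial.C (u i) * Polynomial.X + Polynomial.C (v i) := by
  simp [lineRestrict]

theorem lineRestrict_of_isHomogeneous_one (u v : σ → K) {l : MvPolynomial σ K}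
    (hl : l.IsHomogeneous 1) :
    lineRestrict u v l = Polynomial.C (eval u l) * Polynomial.X + Polynomial.C (eval v l) := by
  have hl' : l ∈ Submodule.span K (Set.range X) := by
    rw [← homogeneousSubmodule_one_eq_span_X]; exact hl
  induction hl' using Submodule.span_induction with
  | mem x hx => obtain ⟨i, rfl⟩ := hx; simp [lineRestrict_X]
  | zero => simp
  | add x y hx hy ihx ihy =>
    rw [← homogeneousSubmodule_one_eq_span_X] at hx hy
    rw [map_add, ihx hx, ihy hy]
    simp only [map_add]
    ring
  | smul c x hx ih =>
    rw [← homogeneousSubmodule_one_eq_span_X] at hx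
    rw [map_smul, ih hx, smul_eval, smul_eval, Polynomial.smul_eq_C_mul]
    simp only [map_mul]
    ring

theorem natDegree_lineRestrict_le (u v : σ → K) {f : MvPolynomial σ K} {m : ℕ}
    (hf : f.IsHomogeneous m) : (lineRestrict u v f).natDegree ≤ m := by
  have := aeval_natDegree_le (n := 1) f hf.totalDegree_le
    (fun i => Polynomial.C (u i) * Polynomial.X + Polynomial.C (v i))
    (fun i => Polynomial.natDegree_linear_le)
  simpa [lineRestrict] using this

/-- Restriction to a line in `𝔸³` whose cone is a plane maps each `S_m` onto the polynomials of
degree at most `m`, and its kernel on `S_m` is generated by the linear form of that plane. -/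
theorem exists_linearForm_of_lineRestrict (u v : Fin 3 → K) (huv : u 0 * v 1 - u 1 * v 0 ≠ 0) :
    ∃ l : MvPolynomial (Fin 3) K, l.IsHomogeneous 1 ∧ l ≠ 0 ∧ lineRestrict u v l = 0 ∧
      (∀ (m : ℕ) (f : MvPolynomial (Fin 3) K), f.IsHomogeneous m → lineRestrict u v f = 0 → l ∣ f) ∧
      (∀ (m : ℕ) (q : Polynomial K), q.natDegree ≤ m →
        ∃ f : MvPolynomial (Fin 3) K, f.IsHomogeneous m ∧ lineRestrict u v f = q) := by
  set δ := u 0 * v 1 - u 1 * v 0 with hδ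
  -- By Cramer's rule, `a` and `b` are the coordinates along `u` and `v` on their span, and `l` cuts
  -- out that plane.
  let a : MvPolynomial (Fin 3) K := C (v 1 / δ) * X 0 - C (v 0 / δ) * X 1
  let b : MvPolynomial (Fin 3) K := C (u 0 / δ) * X 1 - C (u 1 / δ) * X 0
  let l : MvPolynomial (Fin 3) K := X 2 - (C (u 2) * a + C (v 2) * b)
  have ha : a.IsHomogeneous 1 := (isHomogeneous_C_mul_X _ _).sub (isHomogeneous_C_mul_X _ _)
  have hb : b.IsHomogeneous 1 := (isHomogeneous_C_mul_X _ _).sub (isHomogeneous_C_mul_X _ _)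
  have hl : l.IsHomogeneous 1 := (isHomogeneous_X _ _).sub ((ha.C_mul _).add (hb.C_mul _))
  have hra : lineRestrict u v a = Polynomial.X := by
    rw [lineRestrict_of_isHomogeneous_one u v ha]
    have h1 : eval u a = 1 := by simp [a]; field_simp; rw [hδ]; ring
    have h2 : eval v a = 0 := by simp [a]; ring
    simp [h1, h2]
  have hrb : lineRestrict u v b = 1 := by
    rw [lineRestrict_of_isHomogeneous_one u v hb]
    have h1 : eval v b = 1 := by simp [b]; field_simp; rw [hδ]
    have h2 : eval u b = 0 := by simp [b]; ring
    simp [h1, h2]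
  let θ : MvPolynomial (Fin 2) K →ₐ[K] MvPolynomial (Fin 3) K := aeval ![a, b]
  let ρ : MvPolynomial (Fin 3) K →ₐ[K] MvPolynomial (Fin 2) K :=
    aeval fun i => C (u i) * X 0 + C (v i) * X 1
  have hθ : ∀ {g : MvPolynomial (Fin 2) K} {m : ℕ}, g.IsHomogeneous m → (θ g).IsHomogeneous m := by
    intro g m hg
    have hab : ∀ i, (![a, b] i).IsHomogeneous 1 := fun i => by fin_cases i <;> assumption
    have := hg.aeval ![a, b] hab
    rwa [one_mul] at this
  have hρ : ∀ {f : MvPolynomial (Fin 3) K} {m : ℕ}, f.IsHomogeneous m → (ρ f).IsHomogeneous m := by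
    intro f m hf
    have := hf.aeval (fun i => C (u i) * X 0 + C (v i) * X 1 : Fin 3 → MvPolynomial (Fin 2) K)
      (fun i => (isHomogeneous_C_mul_X _ _).add (isHomogeneous_C_mul_X _ _))
    rwa [one_mul] at this
  have hrρ : ∀ f, aeval ![Polynomial.X, 1] (ρ f) = lineRestrict u v f := by
    intro f
    have : (aeval (R := K) ![Polynomial.X, (1 : Polynomial K)]).comp ρ = lineRestrict u v := by
      ext i : 1
      simp [ρ, lineRestrict_X]
    rw [← this]; rfl
  have hrθ : ∀ g, lineRestrict u v (θ g) = aeval ![Polynomial.X, 1] g := by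
    intro g
    have : (lineRestrict u v).comp θ = aeval (R := K) ![Polynomial.X, (1 : Polynomial K)] := by
      ext i : 1
      fin_cases i <;> simp [θ, hra, hrb]
    rw [← this]; rfl
  have hmod : ∀ f, l ∣ f - θ (ρ f) := by
    intro f
    rw [← Ideal.mem_span_singleton, ← Ideal.Quotient.eq]
    have : Ideal.Quotient.mkₐ K (Ideal.span {l}) =
        (Ideal.Quotient.mkₐ K (Ideal.span {l})).comp (θ.comp ρ) := by
      ext i : 1
      simp only [AlgHom.comp_apply, Ideal.Quotient.mkₐ_eq_mk]
      rw [Ideal.Quotient.eq, Ideal.mem_span_singleton]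
      have hi : θ (ρ (X i)) = C (u i) * a + C (v i) * b := by simp [θ, ρ, algebraMap_eq]
      rw [hi]
      have key : ∀ j : Fin 3, j ≠ 2 → X j = C (u j) * a + C (v j) * b := by
        have h1 : (C (u 0) * C (v 1 / δ) - C (v 0) * C (u 1 / δ) : MvPolynomial (Fin 3) K) = 1 := by
          rw [← C_mul, ← C_mul, ← C_sub, ← C_1]; congr 1; field_simp; rw [hδ]; ring
        have h2 : (C (v 0) * C (u 0 / δ) - C (u 0) * C (v 0 / δ) : MvPolynomial (Fin 3) K) = 0 := by
          rw [← C_mul, ← C_mul, ← C_sub, ← C_0]; congr 1; field_simp; ring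
        have h3 : (C (v 1) * C (u 0 / δ) - C (u 1) * C (v 0 / δ) : MvPolynomial (Fin 3) K) = 1 := by
          rw [← C_mul, ← C_mul, ← C_sub, ← C_1]; congr 1; field_simp; rw [hδ]; ring
        have h4 : (C (u 1) * C (v 1 / δ) - C (v 1) * C (u 1 / δ) : MvPolynomial (Fin 3) K) = 0 := by
          rw [← C_mul, ← C_mul, ← C_sub, ← C_0]; congr 1; field_simp; ring
        intro j hj
        fin_cases j
        · simp only [a, b, Fin.zero_eta]
          linear_combination (-X 0) * h1 - X 1 * h2
        · simp only [a, b, Fin.mk_one]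
          linear_combination (-X 1) * h3 - X 0 * h4
        · exact absurd rfl hj
      by_cases h2 : i = 2
      · subst h2; exact dvd_rfl
      · rw [← key i h2, sub_self]; exact dvd_zero _
    exact congrArg (fun ψ => ψ f) this
  refine ⟨l, hl, ?_, ?_, ?_, ?_⟩
  · intro h0
    have := congrArg (eval ![0, 0, 1]) h0
    simp [l, a, b] at this
  · simp only [l, map_sub, map_add, map_mul, hra, hrb, lineRestrict_X]
    simp [lineRestrict]
  · intro m f hf h0
    -- A binary form of known degree is recovered from its dehomogenization.
    have h1 : ρ f = 0 := by
      rw [← Polynomial.homogenize_eq_of_isHomogeneous (hρ hf) ((hrρ f).trans h0)]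
      simp
    simpa [h1] using hmod f
  · intro m q hq
    refine ⟨θ (q.homogenize m), hθ (Polynomial.isHomogeneous_homogenize q), ?_⟩
    rw [hrθ, Polynomial.aeval_homogenize_X_one q hq]

/-- For finitely many pairwise non-proportional linear forms, the restrictions to a general line
have distinct roots. -/
theorem exists_general_line [Infinite K] {ι : Type*} [Fintype ι] (l : ι → MvPolynomial (Fin 3) K)
    (h0 : ∀ i, l i ≠ 0) (hpair : ∀ i j, i ≠ j → ∀ c : K, l i ≠ c • l j) :
    ∃ u v : Fin 3 → K, u 0 * v 1 - u 1 * v 0 ≠ 0 ∧ (∀ i, eval u (l i) ≠ 0) ∧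
      ∀ i j, i ≠ j → eval u (l i) * eval v (l j) - eval u (l j) * eval v (l i) ≠ 0 := by
  classical
  -- The factor `X 0` forces `u 0 ≠ 0`, so the minor is a nonzero polynomial in `v`.
  obtain ⟨u, hu⟩ := exists_eval_ne_zero (p := X 0 * ∏ i, l i)
    (mul_ne_zero (X_ne_zero _) (Finset.prod_ne_zero_iff.2 fun i _ => h0 i))
  rw [map_mul, map_prod, mul_ne_zero_iff, Finset.prod_ne_zero_iff, eval_X] at hu
  have hu' : ∀ i, eval u (l i) ≠ 0 := fun i => hu.2 i (Finset.mem_univ i)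
  have hne : (C (u 0) * X 1 - C (u 1) * X 0 : MvPolynomial (Fin 3) K) ≠ 0 := fun h => by
    have := congrArg (eval ![0, 1, 0]) h
    simp at this
    exact hu.1 this
  obtain ⟨v, hv⟩ := exists_eval_ne_zero
    (p := (C (u 0) * X 1 - C (u 1) * X 0) * ∏ x ∈ (Finset.univ : Finset ι).offDiag,
      (C (eval u (l x.1)) * l x.2 - C (eval u (l x.2)) * l x.1))
    (mul_ne_zero hne (Finset.prod_ne_zero_iff.2 fun x hx h => by
      refine hpair x.2 x.1 (Finset.mem_offDiag.1 hx).2.2.symm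
        (eval u (l x.2) / eval u (l x.1)) ?_
      rw [smul_eq_C_mul, div_eq_inv_mul, C_mul, mul_assoc, ← sub_eq_zero.1 h, ← mul_assoc, ← C_mul,
        inv_mul_cancel₀ (hu' _), C_1, one_mul]))
  rw [map_mul, map_prod, mul_ne_zero_iff, Finset.prod_ne_zero_iff] at hv
  refine ⟨u, v, by simpa using hv.1, hu', fun i j hij => ?_⟩
  simpa using hv.2 (i, j) (by simpa using hij)

/-! ### The weak Lefschetz property -/

theorem hasWLP_of_pairwise [CharZero K] {ι : Type*} [Fintype ι] (l : ι → MvPolynomial (Fin 3) K)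
    (hl : ∀ i, (l i).IsHomogeneous 1) (d : ι → ℕ)
    (h0 : ∀ i, l i ≠ 0) (hpair : ∀ i j, i ≠ j → ∀ c : K, l i ≠ c • l j) :
    HasWLP (Ideal.span (Set.range fun i => l i ^ d i)) := by
  obtain ⟨u, v, huv, hu, hij⟩ := exists_general_line l h0 hpair
  obtain ⟨ℓ, hℓ, hℓ0, hφℓ, hker, hsurj⟩ := exists_linearForm_of_lineRestrict u v huv
  set φ := lineRestrict u v with hφ
  let c : ι → K := fun i => eval u (l i)
  let a : ι → K := fun i => - (eval v (l i) / eval u (l i))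
  have ha : Function.Injective a := by
    intro i j h
    by_contra hne
    refine hij i j hne ?_
    have h' := neg_injective h
    rw [div_eq_div_iff (hu i) (hu j)] at h'
    linear_combination -h'
  have hφl : ∀ i, φ (l i) = Polynomial.C (c i) * (Polynomial.X - Polynomial.C (a i)) := fun i => by
    rw [hφ, lineRestrict_of_isHomogeneous_one u v (hl i), mul_sub, ← Polynomial.C_mul]
    simp only [a, c, mul_neg, map_neg, sub_neg_eq_add, mul_div_cancel₀ _ (hu i)]
  have hφl0 : ∀ i, φ (l i) ≠ 0 := fun i => by
    rw [hφl]
    exact mul_ne_zero (Polynomial.C_ne_zero.2 (hu i)) (Polynomial.X_sub_C_ne_zero _)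
  have hld : ∀ i, (l i ^ d i).IsHomogeneous (d i) := fun i => by simpa using (hl i).pow (d i)
  have hmem : ∀ i, l i ^ d i ∈ Ideal.span (Set.range fun i => l i ^ d i) :=
    fun i => Ideal.subset_span ⟨i, rfl⟩
  refine ⟨ℓ, hℓ, fun m => ?_⟩
  -- Degree `m + 1` on the line has dimension `m + 2`; the two cases are direct sum and spanning.
  rcases le_total (∑ i, (m + 1 + 1 - d i)) (m + 1 + 1) with hd | hd
  · refine Or.inl (mulMap_injective_of_forall hℓ fun f hf hfI => ?_)
    obtain ⟨g, hg, hg0, hgsum⟩ := exists_isHomogeneous_of_mem_span hld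
      (by simpa [add_comm] using hℓ.mul hf) hfI
    have hφg : ∀ i, φ (g i * l i ^ d i) = 0 := by
      refine Polynomial.eq_zero_of_sum_eq_zero_of_X_sub_C_pow_dvd ha (m + 1) d hd _ (fun i => ?_)
        (fun i => ?_) ?_
      · rcases le_or_gt (d i) (m + 1) with hi | hi
        · refine natDegree_lineRestrict_le u v ?_
          have := (hg i).mul (hld i)
          rwa [Nat.sub_add_cancel (by omega)] at this
        · simp [hg0 i (by omega)]
      · rw [map_mul, map_pow, hφl, mul_pow]
        exact Dvd.intro_left _ (mul_assoc _ _ _)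
      · rw [← map_sum, hgsum, map_mul, hφℓ, zero_mul]
    have hdvd : ∀ i, ℓ ∣ g i := fun i => by
      refine hker _ _ (hg i) ?_
      have := hφg i
      rw [map_mul, map_pow] at this
      exact (mul_eq_zero.1 this).resolve_right (pow_ne_zero _ (hφl0 i))
    choose q hq using hdvd
    have hf' : f = ∑ i, q i * l i ^ d i := by
      refine mul_left_cancel₀ hℓ0 ?_
      rw [← hgsum, Finset.mul_sum]
      exact Finset.sum_congr rfl fun i _ => by rw [hq i, mul_assoc]
    rw [hf']
    exact Ideal.sum_mem _ fun i _ => Ideal.mul_mem_left _ _ (hmem i)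
  · refine Or.inr (mulMap_surjective_of_forall hℓ fun f hf => ?_)
    obtain ⟨q, hq0, hqdeg, hqsum⟩ := Polynomial.exists_sum_eq_of_X_sub_C_pow_mul ha (m + 1) d hd
      (φ f) (natDegree_lineRestrict_le u v hf)
    have hlift : ∀ i, ∃ g : MvPolynomial (Fin 3) K, (g * l i ^ d i).IsHomogeneous (m + 1) ∧
        φ (g * l i ^ d i) = (Polynomial.X - Polynomial.C (a i)) ^ d i * q i := by
      intro i
      rcases le_or_gt (d i) (m + 1) with hi | hi
      · obtain ⟨g, hg, hgq⟩ := hsurj (m + 1 - d i) (Polynomial.C ((c i ^ d i)⁻¹) * q i)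
          ((Polynomial.natDegree_C_mul_le _ _).trans (hqdeg i))
        refine ⟨g, ?_, ?_⟩
        · have := hg.mul (hld i)
          rwa [Nat.sub_add_cancel hi] at this
        · have hc : (Polynomial.C ((c i ^ d i)⁻¹) * Polynomial.C (c i) ^ d i : Polynomial K) = 1 := by
            rw [← Polynomial.C_pow, ← Polynomial.C_mul, inv_mul_cancel₀ (pow_ne_zero _ (hu i)),
              Polynomial.C_1]
          rw [map_mul, map_pow, hgq, hφl, mul_pow]
          linear_combination (q i * (Polynomial.X - Polynomial.C (a i)) ^ d i) * hc
      · exact ⟨0, by simpa using isHomogeneous_zero _ _ _, by simp [hq0 i hi]⟩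
    choose g hg hgφ using hlift
    have hdvd : ℓ ∣ f - ∑ i, g i * l i ^ d i := by
      refine hker (m + 1) _ (hf.sub (IsHomogeneous.sum _ _ _ fun i _ => hg i)) ?_
      rw [map_sub, map_sum, ← hqsum, sub_eq_zero]
      exact Finset.sum_congr rfl fun i _ => (hgφ i).symm
    obtain ⟨h, hh, hfh⟩ := exists_isHomogeneous_of_dvd
      (hf.sub (IsHomogeneous.sum _ _ _ fun i _ => hg i)) hℓ hdvd
    refine ⟨h, hh, ?_⟩
    rw [← hfh, sub_sub_cancel_left]
    exact neg_mem (Ideal.sum_mem _ fun i _ => Ideal.mul_mem_left _ _ (hmem i))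

theorem hasWLP_top : HasWLP (⊤ : Ideal (MvPolynomial σ K)) :=
  ⟨0, isHomogeneous_zero _ _ _, fun _ =>
    Or.inl (mulMap_injective_of_forall _ fun _ _ _ => Submodule.mem_top)⟩

theorem exists_finset_irredundant_span_image_eq {R ι : Type*} [CommRing R] [Fintype ι]
    [DecidableEq ι] (f : ι → R) :
    ∃ s : Finset ι, Ideal.span (f '' (s : Set ι)) = Ideal.span (Set.range f) ∧
      ∀ i ∈ s, f i ∉ Ideal.span (f '' (s.erase i : Finset ι)) := by
  obtain ⟨s, hs⟩ := exists_minimal_of_wellFoundedLT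
    (fun s : Finset ι => Ideal.span (f '' (s : Set ι)) = Ideal.span (Set.range f))
    ⟨Finset.univ, by simp⟩
  refine ⟨s, hs.prop, fun i hi hmem => ?_⟩
  have hle : Ideal.span (f '' (s.erase i : Finset ι)) = Ideal.span (Set.range f) := by
    rw [← hs.prop]
    refine le_antisymm (Ideal.span_mono (Set.image_mono (by simp))) (Ideal.span_le.2 ?_)
    rintro _ ⟨j, hj, rfl⟩
    rcases eq_or_ne j i with rfl | hji
    · exact hmem
    · exact Ideal.subset_span ⟨j, by simpa [hji] using hj, rfl⟩
  exact Finset.notMem_erase i s (hs.le_of_le hle (Finset.erase_subset i s) hi)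

/-- In characteristic zero, every ideal of `K[x, y, z]` generated by finitely many powers of linear
forms has the weak Lefschetz property. -/
theorem hasWLP_span_range_linearForm_pow [CharZero K] {ι : Type*} [Fintype ι]
    (l : ι → MvPolynomial (Fin 3) K) (hl : ∀ i, (l i).IsHomogeneous 1) (d : ι → ℕ) :
    HasWLP (Ideal.span (Set.range fun i => l i ^ d i)) := by
  classical
  rcases eq_or_ne (Ideal.span (Set.range fun i => l i ^ d i)) ⊤ with htop | htop
  · rw [htop]; exact hasWLP_top
  obtain ⟨s, hs, hnot⟩ := exists_finset_irredundant_span_image_eq fun i => l i ^ d i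
  have hrange : Ideal.span (Set.range fun i => l i ^ d i) =
      Ideal.span (Set.range fun i : s => l i ^ d i) := by
    rw [← hs]
    congr 1
    ext x
    simp
  -- Otherwise the higher power would be a multiple of the lower one, against irredundancy.
  have hprop : ∀ i ∈ s, ∀ j ∈ s, i ≠ j → d j ≤ d i → ∀ c : K, l i ≠ c • l j := by
    intro i hi j hj hne hd c hc
    refine hnot i hi ?_
    have : l i ^ d i = C c ^ d i * l j ^ (d i - d j) * l j ^ d j := by
      rw [hc, smul_eq_C_mul, mul_pow, mul_assoc, ← pow_add, Nat.sub_add_cancel hd]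
    rw [this]
    exact Ideal.mul_mem_left _ _ (Ideal.subset_span ⟨j, by simp [hj, hne.symm], rfl⟩)
  have hzero : ∀ i ∈ s, l i ≠ 0 := by
    intro i hi h0
    rcases Nat.eq_zero_or_pos (d i) with hd | hd
    · refine htop ((Ideal.eq_top_iff_one _).2 (Ideal.subset_span ⟨i, ?_⟩))
      simp [hd]
    · refine hnot i hi ?_
      simp [h0, hd.ne']
  rw [hrange]
  refine hasWLP_of_pairwise (fun i : s => l i) (fun i => hl i) (fun i => d i)
    (fun i => hzero i i.2) fun i j hij c hc => ?_
  replace hc : l i = c • l j := hc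
  have hij' : (i : ι) ≠ j := Subtype.coe_injective.ne hij
  rcases le_total (d j) (d i) with hd | hd
  · exact hprop i i.2 j j.2 hij' hd c hc
  · have hc0 : c ≠ 0 := by
      rintro rfl
      exact hzero i i.2 (by simpa using hc)
    refine hprop j j.2 i i.2 hij'.symm hd c⁻¹ ?_
    rw [hc, smul_smul, inv_mul_cancel₀ hc0, one_smul]

end WeakLefschetz

theorem proposition2p3 {K : Type*} [Field K] [CharZero K] (n : ℕ)
    (l : Fin n → MvPolynomial (Fin 3) K) (hl : ∀ i, (l i).IsHomogeneous 1)
    (d : Fin n → ℕ)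
    (hArt : IsArtinianRing
      (MvPolynomial (Fin 3) K ⧸ Ideal.span (Set.range fun i => l i ^ d i)))
    -- With indices starting at `0`, `d t` is the exponent `d_{t+1}` of the usual numbering from `1`, and `Iio t` has `t` elements.
    (hd : ∀ t : Fin n, 1 < (t : ℕ) →
      (d t : ℚ) ≤ ((∑ i ∈ Finset.Iio t, (d i : ℚ)) - ((t : ℕ) : ℚ)) / (((t : ℕ) : ℚ) - 1)) :
    WeakLefschetz.HasWLP (Ideal.span (Set.range fun i => l i ^ d i)) := by
  exact WeakLefschetz.hasWLP_span_range_linearForm_pow l hl d
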